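/- Let $(M,g,J)$ be a Kähler surface, i.e. a Kähler manifold of complex dimension $2$, let $E\to M$ be a holomorphic line bundle, and let $\nabla^A$ be any smooth connection on $E$ compatible with the holomorphic structure (that is, $(\nabla^A)^{0,1}=\bar\partial_E$). Let $F_A$ be its curvature $2$-form, a complex-valued $2$-form on $M$. For $p\in M$ let $\mathbb S_p=\bigoplus_{k}\Lambda^{0,k}T_p^*M$ be the space of spinors at $p$ of the canonical $\mathrm{Spin}^c$-structure, with the Hermitian inner product induced by $g$ and with the complex-linear Clifford action of $T_p^*M\otimes\mathbb C$ given in a unitary coframe $\xi^1,\xi^2$ of type $(1,0)$ by $\xi^i\cdot=-\sqrt2\,\bar\xi^i\lrcorner$ and $\bar\xi^i\cdot=\sqrt2\,\bar\xi^i\wedge$; $2$-forms act by $\alpha\wedge\beta\mapsto\frac12(\alpha\beta-\beta\alpha)$. Let $c(F_A(p))$ be the resulting endomorphism of $\mathbb S_p$. Then at every point $p\in M$ with $F_A(p)\neq0$ the operator $c(F_A(p))$ is indefinite. Precisely: 1. neither $c(F_A(p))$ nor $-c(F_A(p))$ is positive semidefinite (an operator $B$ being positive semidefinite if $\langle\psi,B\psi\rangle$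 is real and $\ge0$ for all $\psi\in\mathbb S_p$); 2. if moreover $\nabla^A$ preserves some smooth Hermitian metric on $E$ (so that $\nabla^A$ is its Chern connection), then $c(F_A(p))$ is Hermitian and its quadratic form $\psi\mapsto\langle\psi,c(F_A(p))\psi\rangle$ takes both strictly positive and strictly negative values. -/

import Mathlib

open Bundle
open scoped Manifold ContDiff Topology

noncomputable section

/-! ### Linear algebra of `(0,k)`-forms on a Euclidean vector space with a complex structure -/

namespace KahlerSpinor

section LinearAlgebra

variable {T : Type*} [NormedAddCommGroup T] [InnerProductSpace ℝ T]

/-- The space `Λ^{0,k}` of complex-valued alternating `k`-forms on `(T, J)` which are of type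
`(0,k)`, i.e. conjugate-linear with respect to `J` in every argument. -/
def formZero (J : T →ₗ[ℝ] T) (k : ℕ) : Submodule ℂ (T [⋀^Fin k]→ₗ[ℝ] ℂ) where
  carrier := {ψ | ∀ (v : Fin k → T) (i : Fin k),
    ψ (Function.update v i (J (v i))) = -Complex.I * ψ v}
  add_mem' {a b} ha hb v i := by
    simp only [AlternatingMap.add_apply, ha v i, hb v i]; ring
  zero_mem' v i := by simp
  smul_mem' c a ha v i := by
    simp only [AlternatingMap.smul_apply, ha v i, smul_eq_mul]; ring

/-- The spinor space `S = ⊕_k Λ^{0,k}`. As `Λ^{0,k} = 0` for `k > dim_ℂ T`, only finitely many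
factors are nonzero, and the product over `k` is the direct sum. -/
abbrev Spinor (J : T →ₗ[ℝ] T) : Type _ := ∀ k : ℕ, formZero J k

/-- The `(0,1)`-part `a^{0,1}(v) = (a(v) + i a(Jv)) / 2` of a complex covector. -/
def zeroOnePart (J : T →ₗ[ℝ] T) (a : T →ₗ[ℝ] ℂ) : T →ₗ[ℝ] ℂ :=
  (1 / 2 : ℂ) • (a + Complex.I • (a ∘ₗ J))

/-- The metric dual `v♭ = g(v, ·)` of a vector, as a complex-valued covector. -/
def flat (v : T) : T →ₗ[ℝ] ℂ :=
  Complex.ofRealCLM.toLinearMap ∘ₗ (innerₗ T v)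

/-- The exterior product `a ∧ ψ = ∑ i, (-1)^i a(v i) ψ(v 0, …, v i omitted, …, v k)`
of a covector and a `k`-form. -/
def wedge {k : ℕ} (a : T →ₗ[ℝ] ℂ) (ψ : T [⋀^Fin k]→ₗ[ℝ] ℂ) : T [⋀^Fin (k + 1)]→ₗ[ℝ] ℂ :=
  AlternatingMap.alternatizeUncurryFin
    { toFun := fun v => a v • ψ
      map_add' := fun v w => by rw [map_add, add_smul]
      map_smul' := fun c v => by rw [map_smul, smul_assoc, RingHom.id_apply] }

theorem wedge_apply {k : ℕ} (a : T →ₗ[ℝ] ℂ) (ψ : T [⋀^Fin k]→ₗ[ℝ] ℂ) (v : Fin (k + 1) → T) :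
    wedge a ψ v = ∑ i : Fin (k + 1), (-1) ^ (i : ℕ) * (a (v i) * ψ (i.removeNth v)) := by
  rw [wedge, AlternatingMap.alternatizeUncurryFin_apply]
  refine Finset.sum_congr rfl fun i _ => ?_
  simp

theorem zeroOnePart_J {J : T →ₗ[ℝ] T} (hJ : J ∘ₗ J = -LinearMap.id) (a : T →ₗ[ℝ] ℂ) (v : T) :
    zeroOnePart J a (J v) = -Complex.I * zeroOnePart J a v := by
  have h : J (J v) = -v := by simpa using LinearMap.congr_fun hJ v
  simp only [zeroOnePart, LinearMap.smul_apply, LinearMap.add_apply, LinearMap.comp_apply, h,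
    map_neg, smul_eq_mul]
  linear_combination (a (J v) / 2) * Complex.I_mul_I

theorem wedge_mem {J : T →ₗ[ℝ] T} (hJ : J ∘ₗ J = -LinearMap.id) (a : T →ₗ[ℝ] ℂ) {k : ℕ}
    {ψ : T [⋀^Fin k]→ₗ[ℝ] ℂ} (hψ : ψ ∈ formZero J k) :
    wedge (zeroOnePart J a) ψ ∈ formZero J (k + 1) := by
  intro v i
  rw [wedge_apply, wedge_apply, Finset.mul_sum]
  refine Finset.sum_congr rfl fun j _ => ?_
  rcases eq_or_ne i j with rfl | hij
  · rw [Function.update_self, Fin.removeNth_update, zeroOnePart_J hJ]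
    ring
  · obtain ⟨l, rfl⟩ := Fin.exists_succAbove_eq hij
    have h1 : j.removeNth (Function.update v (j.succAbove l) (J (v (j.succAbove l))))
        = Function.update (j.removeNth v) l (J (j.removeNth v l)) := by
      ext m
      by_cases hm : m = l
      · subst hm; simp [Fin.removeNth]
      · simp [Fin.removeNth, Function.update_of_ne, hm]
    rw [h1, hψ (j.removeNth v) l, Function.update_of_ne hij.symm]
    ring

theorem contract_mem {J : T →ₗ[ℝ] T} (v : T) {k : ℕ} {ψ : T [⋀^Fin (k + 1)]→ₗ[ℝ] ℂ}
    (hψ : ψ ∈ formZero J (k + 1)) : ψ.curryLeft v ∈ formZero J k := by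
  intro w i
  have h := hψ (Matrix.vecCons v w) i.succ
  rw [AlternatingMap.curryLeft_apply_apply, AlternatingMap.curryLeft_apply_apply, ← h]
  congr 1
  ext m
  refine Fin.cases ?_ (fun m => ?_) m
  · simp [Function.update_of_ne (Fin.succ_ne_zero i).symm]
  · by_cases hm : m = i
    · subst hm; simp
    · simp [Function.update_of_ne, hm]

/-- Exterior multiplication of spinors by the `(0,1)`-part of a covector. -/
def wedgeEnd {J : T →ₗ[ℝ] T} (hJ : J ∘ₗ J = -LinearMap.id) (a : T →ₗ[ℝ] ℂ) :
    Spinor J →ₗ[ℂ] Spinor J where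
  toFun ψ
    | 0 => 0
    | k + 1 => ⟨wedge (zeroOnePart J a) (ψ k : T [⋀^Fin k]→ₗ[ℝ] ℂ), wedge_mem hJ a (ψ k).2⟩
  map_add' φ ψ := by
    funext k
    match k with
    | 0 => simp
    | k + 1 =>
      ext v
      simp [wedge_apply, mul_add, Finset.sum_add_distrib]
  map_smul' c ψ := by
    funext k
    match k with
    | 0 => simp
    | k + 1 =>
      ext v
      simp only [wedge_apply, Pi.smul_apply, Submodule.coe_smul, AlternatingMap.smul_apply,
        smul_eq_mul, RingHom.id_apply, Finset.mul_sum]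
      exact Finset.sum_congr rfl fun i _ => by ring

/-- Contraction `v ⌟ ψ = ψ(v, ·, …)` of spinors with a real vector. On `(0,k)`-forms this is the
contraction with the component of `v` in `T^{0,1}`. -/
def contractEnd (J : T →ₗ[ℝ] T) (v : T) : Spinor J →ₗ[ℂ] Spinor J where
  toFun ψ k := ⟨(ψ (k + 1) : T [⋀^Fin (k + 1)]→ₗ[ℝ] ℂ).curryLeft v, contract_mem v (ψ (k + 1)).2⟩
  map_add' φ ψ := by funext k; ext w; simp
  map_smul' c ψ := by funext k; ext w; simp

/-- Clifford multiplication by a real vector `v`, identified with the covector `v♭`: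
`c(v) ψ = √2 ((v♭)^{0,1} ∧ ψ - v ⌟ ψ)`. Its complex-linear extension satisfies
`c(ξ^i) = -√2 ξ̄^i ⌟` and `c(ξ̄^i) = √2 ξ̄^i ∧` in a unitary coframe `ξ^i`. -/
def clifford {J : T →ₗ[ℝ] T} (hJ : J ∘ₗ J = -LinearMap.id) (v : T) :
    Spinor J →ₗ[ℂ] Spinor J :=
  ((Real.sqrt 2 : ℝ) : ℂ) • (wedgeEnd hJ (flat v) - contractEnd J v)

variable [FiniteDimensional ℝ T]

/-- Clifford action of a complex-valued 2-form. With an orthonormal basis `e_i` of `T` and its dual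
basis `e^i`, `η = ½ ∑_{i,j} η(e_i, e_j) e^i ∧ e^j`, and `α ∧ β` acts as
`½ (c(α) c(β) - c(β) c(α))`. -/
def cliffordTwoForm {J : T →ₗ[ℝ] T} (hJ : J ∘ₗ J = -LinearMap.id) (η : T [⋀^Fin 2]→ₗ[ℝ] ℂ) :
    Spinor J →ₗ[ℂ] Spinor J :=
  let e := stdOrthonormalBasis ℝ T
  (1 / 2 : ℂ) • ∑ i, ∑ j, η ![e i, e j] •
    ((1 / 2 : ℂ) • (clifford hJ (e i) ∘ₗ clifford hJ (e j) -
      clifford hJ (e j) ∘ₗ clifford hJ (e i)))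

/-- The Hermitian inner product on spinors induced by the metric (conjugate-linear in the first
argument): the summands are orthogonal and
`⟨φ, ψ⟩ = (1/k!) ∑_{i_1,…,i_k} conj (φ(e_{i_1},…,e_{i_k})) ψ(e_{i_1},…,e_{i_k})` on `k`-forms,
for an orthonormal basis `e_i` of `T`. -/
def spinorInner (J : T →ₗ[ℝ] T) (φ ψ : Spinor J) : ℂ :=
  let e := stdOrthonormalBasis ℝ T
  ∑ k ∈ Finset.range (Module.finrank ℝ T + 1), (1 / (k.factorial : ℂ)) *
    ∑ f : Fin k → Fin (Module.finrank ℝ T),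
      starRingEnd ℂ ((φ k : T [⋀^Fin k]→ₗ[ℝ] ℂ) (e ∘ f)) *
        (ψ k : T [⋀^Fin k]→ₗ[ℝ] ℂ) (e ∘ f)

/-- An operator on spinors is positive semidefinite if all `⟨ψ, Aψ⟩` are real and `≥ 0`. -/
def IsPosSemidef {J : T →ₗ[ℝ] T} (A : Spinor J →ₗ[ℂ] Spinor J) : Prop :=
  ∀ ψ, (spinorInner J ψ (A ψ)).im = 0 ∧ 0 ≤ (spinorInner J ψ (A ψ)).re

/-- The operator is self-adjoint for the spinor inner product. -/
def IsHermitianOp {J : T →ₗ[ℝ] T} (A : Spinor J →ₗ[ℂ] Spinor J) : Prop :=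
  ∀ φ ψ, spinorInner J (A φ) ψ = spinorInner J φ (A ψ)

/-- A Hermitian operator is indefinite if its quadratic form takes positive and negative values. -/
def IsIndefinite {J : T →ₗ[ℝ] T} (A : Spinor J →ₗ[ℂ] Spinor J) : Prop :=
  IsHermitianOp A ∧ (∃ ψ, 0 < (spinorInner J ψ (A ψ)).re) ∧ ∃ ψ, (spinorInner J ψ (A ψ)).re < 0

end LinearAlgebra

end KahlerSpinor

/-! ### The real manifold and the real vector bundle underlying a holomorphic line bundle -/

section Underlying

variable {V : Type*} [NormedAddCommGroup V] [NormedSpace ℂ V]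
  {M : Type*} [TopologicalSpace M] [ChartedSpace V M]

/-- A complex manifold is a smooth real manifold. -/
instance complexManifold_isManifold_real [IsManifold 𝓘(ℂ, V) ω M] : IsManifold 𝓘(ℝ, V) ∞ M := by
  refine isManifold_of_contDiffOn _ _ _ fun e e' he he' => ?_
  have h := (contDiffGroupoid ω 𝓘(ℂ, V)).compatible he he'
  rw [contDiffGroupoid, mem_groupoid_of_pregroupoid] at h
  exact (ContDiffOn.restrict_scalars ℝ h.1).of_le le_top

instance tangentSpace_finiteDimensional [FiniteDimensional ℂ V] (x : M) :
    FiniteDimensional ℝ (TangentSpace 𝓘(ℝ, V) x) :=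
  inferInstanceAs (FiniteDimensional ℝ V)

/-- The almost complex structure `J` (multiplication by `i`) on the real tangent spaces. -/
def complexStructure (x : M) :
    TangentSpace 𝓘(ℝ, V) x →L[ℝ] TangentSpace 𝓘(ℝ, V) x :=
  ((Complex.I • ContinuousLinearMap.id ℂ V : V →L[ℂ] V).restrictScalars ℝ : V →L[ℝ] V)

theorem complexStructure_sq (x : M) :
    (complexStructure (V := V) x).toLinearMap ∘ₗ (complexStructure (V := V) x).toLinearMap
      = -LinearMap.id := by
  have h : ∀ v : V, Complex.I • (Complex.I • v) = -v := fun v => by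
    rw [smul_smul, Complex.I_mul_I, neg_one_smul]
  exact LinearMap.ext h

variable (L : M → Type*) [TopologicalSpace (TotalSpace ℂ L)] [∀ x, AddCommGroup (L x)]
  [∀ x, Module ℂ (L x)] [∀ x, TopologicalSpace (L x)] [FiberBundle ℂ L] [VectorBundle ℂ ℂ L]

/-- A complex line bundle is a real vector bundle. -/
instance complexLineBundle_vectorBundle_real : VectorBundle ℝ ℂ L where
  trivialization_linear' e _ := ⟨fun b hb =>
    { map_add := (e.linear ℂ hb).map_add
      map_smul := fun c x => by
        have := (e.linear ℂ hb).map_smul (c : ℂ) x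
        simpa using this }⟩
  continuousOn_coordChange' e e' _ _ := by
    have h := continuousOn_coordChange ℂ e e'
    exact ((ContinuousLinearMap.restrictScalarsL ℂ ℂ ℂ ℝ ℝ).continuous.comp_continuousOn h).congr
      fun b hb => by
        ext
        simp [Trivialization.coordChangeL_apply' _ _ hb]

instance complexFiber_continuousSMul_real [∀ x, ContinuousSMul ℂ (L x)] (x : M) :
    ContinuousSMul ℝ (L x) :=
  IsScalarTower.continuousSMul ℂ

end Underlying

/-! ### Kähler metrics, connections and curvature -/

namespace KahlerSpinor

section Geometry

variable {V : Type*} [NormedAddCommGroup V] [NormedSpace ℂ V]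
  {M : Type*} [TopologicalSpace M] [ChartedSpace V M]

/-- The fundamental 2-form `ω(v, w) = g(Jv, w)` read in the chart `chartAt V x₀`, at a point `y`
of the image of the chart. -/
def fundamentalFormInChart [RiemannianBundle (fun x : M => TangentSpace 𝓘(ℝ, V) x)]
    (x₀ : M) (y v w : V) : ℝ :=
  let φ := chartAt V x₀
  let dφ := mfderiv 𝓘(ℝ, V) 𝓘(ℝ, V) φ.symm y
  inner ℝ (complexStructure (φ.symm y) (dφ v)) (dφ w)

variable (V M) in
/-- The Riemannian metric on the complex manifold `M` is Kähler: `J` is orthogonal and the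
fundamental 2-form is closed. Closedness is
`dω(u, v, w) = ∂_u ω(v, w) + ∂_v ω(w, u) + ∂_w ω(u, v) = 0` for constant `u, v, w` in charts. -/
class IsKahler [RiemannianBundle (fun x : M => TangentSpace 𝓘(ℝ, V) x)] : Prop where
  inner_J (x : M) (v w : TangentSpace 𝓘(ℝ, V) x) :
    inner ℝ (complexStructure x v) (complexStructure x w) = inner ℝ v w
  closed (x₀ : M) (y : V) (hy : y ∈ (chartAt V x₀).target) (u v w : V) :
    fderiv ℝ (fun z => fundamentalFormInChart x₀ z v w) y u +
    fderiv ℝ (fun z => fundamentalFormInChart x₀ z w u) y v +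
    fderiv ℝ (fun z => fundamentalFormInChart x₀ z u v) y w = 0

variable {L : M → Type*} [TopologicalSpace (TotalSpace ℂ L)] [∀ x, AddCommGroup (L x)]
  [∀ x, Module ℂ (L x)] [∀ x, TopologicalSpace (L x)] [∀ x, IsTopologicalAddGroup (L x)]
  [∀ x, ContinuousSMul ℂ (L x)] [FiberBundle ℂ L] [VectorBundle ℂ ℂ L]

variable (V) in
/-- The section `σ` of `L` is smooth (in the real sense) at `x`. -/
def SmoothSectionAt (σ : Π x, L x) (x : M) : Prop :=
  ContMDiffAt 𝓘(ℝ, V) (𝓘(ℝ, V).prod 𝓘(ℝ, ℂ)) ∞ (fun y => TotalSpace.mk' ℂ y (σ y)) x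

variable (V) in
/-- The section `σ` of `L` is holomorphic near `x`. -/
def HolomorphicSectionAt (σ : Π x, L x) (x : M) : Prop :=
  ContMDiffAt 𝓘(ℂ, V) (𝓘(ℂ, V).prod 𝓘(ℂ, ℂ)) ω (fun y => TotalSpace.mk' ℂ y (σ y)) x

/-- A covariant derivative on the underlying real bundle (`D σ x v` is `∇_v σ` at `x`) is a smooth
connection on the complex line bundle `L`, i.e. it is smooth and complex-linear in sections. -/
structure IsComplexConnection [IsManifold 𝓘(ℂ, V) ω M] (D : CovariantDerivative 𝓘(ℝ, V) ℂ L) :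
    Prop where
  smooth : CovariantDerivative.ContMDiffCovariantDerivative D ∞
  map_I_smul (σ : Π x, L x) (x : M) (hσ : SmoothSectionAt V σ x) (v : TangentSpace 𝓘(ℝ, V) x) :
    D (fun y => Complex.I • σ y) x v = Complex.I • D σ x v

/-- The connection is compatible with the holomorphic structure: its `(0,1)`-part is the
`∂̄`-operator of `L`, i.e. `∇_{Jv} σ = i ∇_v σ` for local holomorphic sections `σ`. -/
def IsCompatibleWithHolomorphicStructure (D : CovariantDerivative 𝓘(ℝ, V) ℂ L) : Prop :=
  ∀ (σ : Π x, L x) (x : M), HolomorphicSectionAt V σ x → ∀ v : TangentSpace 𝓘(ℝ, V) x,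
    D σ x (complexStructure x v) = Complex.I • D σ x v

variable (V L) in
/-- A smooth Hermitian metric on the fibres of `L`, conjugate-linear in the first argument. -/
structure HermitianMetric where
  inner (x : M) : L x →ₗ⋆[ℂ] L x →ₗ[ℂ] ℂ
  conj_symm (x : M) (s t : L x) : starRingEnd ℂ (inner x s t) = inner x t s
  pos (x : M) (s : L x) (hs : s ≠ 0) : 0 < (inner x s s).re
  smooth (σ τ : Π x, L x) (x : M) (hσ : SmoothSectionAt V σ x) (hτ : SmoothSectionAt V τ x) :
    ContMDiffAt 𝓘(ℝ, V) 𝓘(ℝ, ℂ) ∞ (fun y => inner y (σ y) (τ y)) x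

/-- The connection preserves the Hermitian metric:
`d(h(σ, τ))(v) = h(∇_v σ, τ) + h(σ, ∇_v τ)` for local smooth sections and real vectors `v`. -/
def IsUnitary (D : CovariantDerivative 𝓘(ℝ, V) ℂ L) (h : HermitianMetric V L) : Prop :=
  ∀ (σ τ : Π x, L x) (x : M), SmoothSectionAt V σ x → SmoothSectionAt V τ x →
    ∀ v : TangentSpace 𝓘(ℝ, V) x,
      mfderiv 𝓘(ℝ, V) 𝓘(ℝ, ℂ) (fun y => h.inner y (σ y) (τ y)) x v =
        h.inner x (D σ x v) (τ x) + h.inner x (σ x) (D τ x v)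

/-- The local frame of `L` around `p` given by the preferred trivialization at `p`. -/
def localFrame (L : M → Type*) [TopologicalSpace (TotalSpace ℂ L)] [∀ x, AddCommGroup (L x)]
    [∀ x, TopologicalSpace (L x)] [FiberBundle ℂ L] (p x : M) : L x :=
  (trivializationAt ℂ L p).symm x 1

/-- The connection 1-form `θ` of `∇` in the local frame `s` around `p`: `∇_v s = θ(v) s`. -/
def connectionForm (D : CovariantDerivative 𝓘(ℝ, V) ℂ L) (p x : M) :
    TangentSpace 𝓘(ℝ, V) x →L[ℝ] ℂ :=
  (trivializationAt ℂ L p).continuousLinearMapAt ℝ x ∘L D (localFrame L p) x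

/-- The connection 1-form around `p`, read in the chart of `M` around `p`. -/
def connectionFormInChart (D : CovariantDerivative 𝓘(ℝ, V) ℂ L) (p : M) (y : V) :
    V [⋀^Fin 1]→L[ℝ] ℂ :=
  let φ := chartAt V p
  ContinuousAlternatingMap.ofSubsingleton ℝ V ℂ (0 : Fin 1)
    (connectionForm D p (φ.symm y) ∘L mfderiv 𝓘(ℝ, V) 𝓘(ℝ, V) φ.symm y)

/-- The curvature 2-form `F(p) = dθ(p)` of a connection on a line bundle, where `θ` is the
connection form in a local frame; the exterior derivative is computed in the chart at `p` and
pulled back to `T_pM`. -/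
def curvature (D : CovariantDerivative 𝓘(ℝ, V) ℂ L) (p : M) :
    TangentSpace 𝓘(ℝ, V) p [⋀^Fin 2]→L[ℝ] ℂ :=
  (extDeriv (connectionFormInChart D p) (chartAt V p p)).compContinuousLinearMap
    (mfderiv 𝓘(ℝ, V) 𝓘(ℝ, V) (chartAt V p) p : TangentSpace 𝓘(ℝ, V) p →L[ℝ] V)

/-- The curvature `F(p)` acting by Clifford multiplication on the spinor space
`S_p = ⊕_k Λ^{0,k} T_p^*M`. -/
def curvatureOnSpinors [FiniteDimensional ℂ V]
    [RiemannianBundle (fun x : M => TangentSpace 𝓘(ℝ, V) x)]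
    (D : CovariantDerivative 𝓘(ℝ, V) ℂ L) (p : M) :
    Spinor (complexStructure (V := V) p).toLinearMap →ₗ[ℂ]
      Spinor (complexStructure (V := V) p).toLinearMap :=
  cliffordTwoForm (complexStructure_sq p) (curvature D p).toAlternatingMap

end Geometry

end KahlerSpinor

open KahlerSpinor

/-!
The theorem splits into a statement about 2-forms in real dimension four and a statement about
curvature.

Clifford multiplication by real vectors satisfies `c(v) c(w) + c(w) c(v) = -2 g(v, w)`
(`clifford_clifford_add_swap`) and is skew-adjoint (`spinorInner_clifford_left`), so the operators
`c(e_k)` of an orthonormal basis are unitary. Commuting `c(η)` past `c(e_k)` gives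
`∑ k, c(e_k) c(η) c(e_k) = (4 - n) c(η)` in real dimension `n`, which vanishes for `n = 4`
(`sum_clifford_cliffordTwoForm_clifford`). If `c(η)` is positive semidefinite, then so are its
unitary conjugates `-c(e_k) c(η) c(e_k)`; since these add up to zero, each of them is zero, hence
`c(η) = 0`, and `η = 0` because the Clifford action on 2-forms is faithful
(`eq_zero_of_isPosSemidef_cliffordTwoForm`). Applied to `η` and `-η` this shows that a nonzero
2-form acts neither positive nor negative semidefinitely.

If the connection preserves a Hermitian metric `h`, and `θ` is its connection form in the local
frame `s`, then `Re θ = d (log h(s, s)) / 2` is exact, so the curvature `dθ` is purely imaginary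
(`re_curvature_eq_zero`). A purely imaginary 2-form acts as a Hermitian operator, whose quadratic
form is real; not being semidefinite, it takes both signs (`isIndefinite_cliffordTwoForm`).
-/

/-! ### Creation and annihilation operators on spinors -/

namespace KahlerSpinor

section Relations

variable {T : Type*} [NormedAddCommGroup T] [InnerProductSpace ℝ T] {J : T →ₗ[ℝ] T}

@[simp]
theorem wedgeEnd_zero (hJ : J ∘ₗ J = -LinearMap.id) (a : T →ₗ[ℝ] ℂ) (ψ : Spinor J) :
    wedgeEnd hJ a ψ 0 = 0 := rfl

@[simp]
theorem coe_wedgeEnd_succ (hJ : J ∘ₗ J = -LinearMap.id) (a : T →ₗ[ℝ] ℂ) (ψ : Spinor J) (k : ℕ) :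
    (wedgeEnd hJ a ψ (k + 1) : T [⋀^Fin (k + 1)]→ₗ[ℝ] ℂ) = wedge (zeroOnePart J a) (ψ k) := rfl

@[simp]
theorem coe_contractEnd (v : T) (ψ : Spinor J) (k : ℕ) :
    (contractEnd J v ψ k : T [⋀^Fin k]→ₗ[ℝ] ℂ) =
      (ψ (k + 1) : T [⋀^Fin (k + 1)]→ₗ[ℝ] ℂ).curryLeft v := rfl

theorem wedge_wedge_add_swap {k : ℕ} (a b : T →ₗ[ℝ] ℂ) (ψ : T [⋀^Fin k]→ₗ[ℝ] ℂ) :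
    wedge a (wedge b ψ) + wedge b (wedge a ψ) = 0 := by
  -- The sum is the double alternatization of the symmetric bilinear map
  -- `(v, w) ↦ (a v * b w + b v * a w) • ψ`.
  let f : T →ₗ[ℝ] T →ₗ[ℝ] T [⋀^Fin k]→ₗ[ℝ] ℂ :=
    LinearMap.mk₂ ℝ (fun v w => (a v * b w + b v * a w) • ψ)
      (fun v v' w => by simp only [map_add]; module)
      (fun c v w => by ext x; simp; ring)
      (fun v w w' => by simp only [map_add]; module)
      (fun c v w => by ext x; simp; ring)
  have h := AlternatingMap.alternatizeUncurryFin_alternatizeUncurryFinLM_comp_of_symmetric (f := f)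
    (fun x y => by simp only [f, LinearMap.mk₂_apply]; module)
  rw [← h]
  ext v
  simp only [AlternatingMap.add_apply, wedge_apply, AlternatingMap.alternatizeUncurryFin_apply,
    LinearMap.comp_apply, AlternatingMap.alternatizeUncurryFinLM_apply, f, LinearMap.mk₂_apply,
    ← Finset.sum_add_distrib, Finset.mul_sum, AlternatingMap.smul_apply, Finset.smul_sum]
  refine Finset.sum_congr rfl fun i _ => Finset.sum_congr rfl fun j _ => ?_
  simp only [smul_eq_mul, zsmul_eq_mul]
  push_cast
  ring

theorem curryLeft_wedge {k : ℕ} (a : T →ₗ[ℝ] ℂ) (ψ : T [⋀^Fin (k + 1)]→ₗ[ℝ] ℂ) (v : T) :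
    (wedge a ψ).curryLeft v = a v • ψ - wedge a (ψ.curryLeft v) := by
  ext w
  simp only [AlternatingMap.curryLeft_apply_apply, AlternatingMap.sub_apply,
    AlternatingMap.smul_apply, wedge_apply, Fin.sum_univ_succ (n := k + 1)]
  rw [sub_eq_add_neg, ← Finset.sum_neg_distrib]
  congr 1
  · simp [Matrix.vecCons]
  · refine Finset.sum_congr rfl fun i _ => ?_
    have : i.succ.removeNth (Matrix.vecCons v w) = Matrix.vecCons v (i.removeNth w) := by
      ext m
      refine Fin.cases ?_ (fun m => ?_) m <;> simp [Fin.removeNth]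
    rw [this]
    simp [pow_succ]

theorem curryLeft_wedge_zero (a : T →ₗ[ℝ] ℂ) (ψ : T [⋀^Fin 0]→ₗ[ℝ] ℂ) (v : T) :
    (wedge a ψ).curryLeft v = a v • ψ := by
  ext w
  simp [AlternatingMap.curryLeft_apply_apply, wedge_apply, Subsingleton.elim _ w]

theorem wedgeEnd_wedgeEnd_add_swap (hJ : J ∘ₗ J = -LinearMap.id) (a b : T →ₗ[ℝ] ℂ)
    (ψ : Spinor J) :
    wedgeEnd hJ a (wedgeEnd hJ b ψ) + wedgeEnd hJ b (wedgeEnd hJ a ψ) = 0 := by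
  funext k
  match k with
  | 0 => simp
  | 1 =>
    ext v
    simp [wedge_apply]
  | k + 2 => exact Subtype.ext (wedge_wedge_add_swap _ _ _)

theorem contractEnd_contractEnd_add_swap (v w : T) (ψ : Spinor J) :
    contractEnd J v (contractEnd J w ψ) + contractEnd J w (contractEnd J v ψ) = 0 := by
  funext k
  apply Subtype.ext
  have h (x : T) := AlternatingMap.curryLeft_same (ψ (k + 2) : T [⋀^Fin (k + 2)]→ₗ[ℝ] ℂ) x
  have h1 := h (v + w)
  simp only [map_add, AlternatingMap.curryLeft_add, LinearMap.add_apply, h] at h1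
  simpa [add_comm] using h1

theorem contractEnd_wedgeEnd_add_swap (hJ : J ∘ₗ J = -LinearMap.id) (a : T →ₗ[ℝ] ℂ) (v : T)
    (ψ : Spinor J) :
    contractEnd J v (wedgeEnd hJ a ψ) + wedgeEnd hJ a (contractEnd J v ψ) =
      zeroOnePart J a v • ψ := by
  funext k
  apply Subtype.ext
  match k with
  | 0 => simp [curryLeft_wedge_zero]
  | k + 1 => simp [curryLeft_wedge]

theorem inner_J_right (hJ : J ∘ₗ J = -LinearMap.id)
    (hiso : ∀ v w, inner ℝ (J v) (J w) = inner ℝ v w) (v w : T) :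
    inner ℝ v (J w) = -inner ℝ (J v) w := by
  have h : J (J w) = -w := by simpa using LinearMap.congr_fun hJ w
  rw [← hiso v (J w), h, inner_neg_right]

theorem zeroOnePart_flat_add_swap (hJ : J ∘ₗ J = -LinearMap.id)
    (hiso : ∀ v w, inner ℝ (J v) (J w) = inner ℝ v w) (v w : T) :
    zeroOnePart J (flat v) w + zeroOnePart J (flat w) v = (inner ℝ v w : ℝ) := by
  have h := inner_J_right hJ hiso v w
  simp only [zeroOnePart, flat, LinearMap.smul_apply, LinearMap.add_apply, LinearMap.comp_apply,
    innerₗ_apply_apply, smul_eq_mul, ContinuousLinearMap.coe_coe, Complex.ofRealCLM_apply]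
  rw [real_inner_comm v w, real_inner_comm (J v) w, h]
  push_cast
  ring

/-- The Clifford relation `c(v) c(w) + c(w) c(v) = -2 g(v, w)`. -/
theorem clifford_clifford_add_swap (hJ : J ∘ₗ J = -LinearMap.id)
    (hiso : ∀ v w, inner ℝ (J v) (J w) = inner ℝ v w) (v w : T) (ψ : Spinor J) :
    clifford hJ v (clifford hJ w ψ) + clifford hJ w (clifford hJ v ψ) =
      (-2 * (inner ℝ v w : ℝ) : ℂ) • ψ := by
  have h1 := wedgeEnd_wedgeEnd_add_swap hJ (flat v) (flat w) ψ
  have h2 := contractEnd_contractEnd_add_swap v w ψ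
  have h3 := contractEnd_wedgeEnd_add_swap hJ (flat w) v ψ
  have h4 := contractEnd_wedgeEnd_add_swap hJ (flat v) w ψ
  have hs : (((Real.sqrt 2 : ℝ) : ℂ) * ((Real.sqrt 2 : ℝ) : ℂ)) = 2 := by
    rw [← Complex.ofReal_mul, Real.mul_self_sqrt (by norm_num)]; simp
  rw [← zeroOnePart_flat_add_swap hJ hiso v w]
  simp only [clifford, LinearMap.smul_apply, LinearMap.sub_apply, map_smul, map_sub, smul_sub, smul_smul,
    hs]
  linear_combination (norm := module) (2 : ℂ) • h1 + (2 : ℂ) • h2 - (2 : ℂ) • h3 - (2 : ℂ) • h4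

end Relations

end KahlerSpinor

/-! ### The Hermitian inner product on spinors -/

namespace KahlerSpinor

section Inner

variable {T : Type*} [NormedAddCommGroup T] [InnerProductSpace ℝ T]
  {J : T →ₗ[ℝ] T}

theorem alternatingMap_eq_zero_of_basis {n k : ℕ} (e : OrthonormalBasis (Fin n) ℝ T)
    {ψ : T [⋀^Fin k]→ₗ[ℝ] ℂ} (h : ∀ f : Fin k → Fin n, ψ (e ∘ f) = 0) : ψ = 0 :=
  e.toBasis.ext_alternating fun f _ => by simpa using! h f

theorem alternatingMap_eq_zero_of_lt {n k : ℕ} (e : OrthonormalBasis (Fin n) ℝ T) (hk : n < k)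
    (ψ : T [⋀^Fin k]→ₗ[ℝ] ℂ) : ψ = 0 :=
  e.toBasis.ext_alternating fun f hf =>
    absurd (Fintype.card_le_of_injective f hf) (by simpa using hk)

/-- On `(0,k+1)`-forms, contraction with `v` is the sum of the contractions with the basis vectors
`e m`, weighted by the conjugates of the coefficients of `(v♭)^{0,1}`. -/
theorem sum_conj_zeroOnePart_flat_mul (hJ : J ∘ₗ J = -LinearMap.id)
    (hiso : ∀ v w, inner ℝ (J v) (J w) = inner ℝ v w) {n k : ℕ}
    (e : OrthonormalBasis (Fin n) ℝ T) (v : T) {ψ : T [⋀^Fin (k + 1)]→ₗ[ℝ] ℂ}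
    (hψ : ψ ∈ formZero J (k + 1)) (w : Fin k → T) :
    ∑ m, starRingEnd ℂ (zeroOnePart J (flat v) (e m)) * ψ (Matrix.vecCons (e m) w) =
      ψ (Matrix.vecCons v w) := by
  have hsum (x : T) : ∑ m, ((inner ℝ x (e m) : ℝ) : ℂ) * ψ (Matrix.vecCons (e m) w) =
      ψ (Matrix.vecCons x w) := by
    let l : T →ₗ[ℝ] ℂ :=
      { toFun := fun x => ψ (Matrix.vecCons x w)
        map_add' := fun x y => ψ.map_vecCons_add w x y
        map_smul' := fun c x => ψ.map_vecCons_smul w c x }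
    change _ = l x
    conv_rhs => rw [← e.sum_repr' x, map_sum]
    refine Finset.sum_congr rfl fun m _ => ?_
    rw [real_inner_comm, map_smul, Complex.real_smul]
    rfl
  have hJv : ψ (Matrix.vecCons (J v) w) = -Complex.I * ψ (Matrix.vecCons v w) := by
    simpa [Matrix.vecCons] using hψ (Matrix.vecCons v w) 0
  have hterm (m : Fin n) : starRingEnd ℂ (zeroOnePart J (flat v) (e m)) =
      (1 / 2) * (((inner ℝ v (e m) : ℝ) : ℂ) + Complex.I * ((inner ℝ (J v) (e m) : ℝ) : ℂ)) := by
    simp [zeroOnePart, flat, inner_J_right hJ hiso, Complex.conj_ofNat, mul_add]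
  simp only [hterm, mul_assoc, add_mul, ← Finset.mul_sum, Finset.sum_add_distrib, hsum, hJv]
  linear_combination (-(1 / 2 : ℂ) * ψ (Matrix.vecCons v w)) * Complex.I_mul_I

theorem sum_conj_wedge_mul (hJ : J ∘ₗ J = -LinearMap.id)
    (hiso : ∀ v w, inner ℝ (J v) (J w) = inner ℝ v w) {n k : ℕ}
    (e : OrthonormalBasis (Fin n) ℝ T) (v : T) (φ : T [⋀^Fin k]→ₗ[ℝ] ℂ)
    {ψ : T [⋀^Fin (k + 1)]→ₗ[ℝ] ℂ} (hψ : ψ ∈ formZero J (k + 1)) :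
    ∑ f : Fin (k + 1) → Fin n,
        starRingEnd ℂ (wedge (zeroOnePart J (flat v)) φ (e ∘ f)) * ψ (e ∘ f) =
      (k + 1) * ∑ f : Fin k → Fin n,
        starRingEnd ℂ (φ (e ∘ f)) * ψ (Matrix.vecCons v (e ∘ f)) := by
  simp only [wedge_apply, map_sum, Finset.sum_mul]
  rw [Finset.sum_comm]
  -- By antisymmetry, the `k + 1` positions of the covector contribute equally.
  have hpos (i : Fin (k + 1)) :
      ∑ f : Fin (k + 1) → Fin n, starRingEnd ℂ ((-1) ^ (i : ℕ) *
        (zeroOnePart J (flat v) ((e ∘ f) i) * φ (i.removeNth (e ∘ f)))) * ψ (e ∘ f) =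
      ∑ f : Fin k → Fin n, starRingEnd ℂ (φ (e ∘ f)) * ψ (Matrix.vecCons v (e ∘ f)) := by
    rw [← (Fin.insertNthEquiv (fun _ => Fin n) i).sum_comp, Fintype.sum_prod_type,
      Finset.sum_comm]
    refine Finset.sum_congr rfl fun f _ => ?_
    rw [← sum_conj_zeroOnePart_flat_mul hJ hiso e v hψ, Finset.mul_sum]
    refine Finset.sum_congr rfl fun m _ => ?_
    have h1 : (e ∘ (Fin.insertNthEquiv (fun _ => Fin n) i) (m, f) : Fin (k + 1) → T) =
        i.insertNth (e m) (e ∘ f) := by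
      ext j
      refine Fin.succAboveCases i ?_ (fun j => ?_) j <;> simp
    rw [h1, ← AlternatingMap.neg_one_pow_smul_map_insertNth ψ i (e m) (e ∘ f)]
    simp
    ring
  rw [Finset.sum_congr rfl fun i _ => hpos i]
  simp

variable [FiniteDimensional ℝ T]

theorem spinorInner_add_left (φ φ' ψ : Spinor J) :
    spinorInner J (φ + φ') ψ = spinorInner J φ ψ + spinorInner J φ' ψ := by
  simp [spinorInner, add_mul, Finset.sum_add_distrib, mul_add]

theorem spinorInner_smul_left (c : ℂ) (φ ψ : Spinor J) :
    spinorInner J (c • φ) ψ = starRingEnd ℂ c * spinorInner J φ ψ := by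
  simp only [spinorInner, Finset.mul_sum, Pi.smul_apply, Submodule.coe_smul,
    AlternatingMap.smul_apply, smul_eq_mul, map_mul]
  exact Finset.sum_congr rfl fun k _ => Finset.sum_congr rfl fun f _ => by ring

theorem conj_spinorInner (φ ψ : Spinor J) :
    starRingEnd ℂ (spinorInner J φ ψ) = spinorInner J ψ φ := by
  simp [spinorInner, mul_comm]

theorem spinorInner_add_right (φ ψ ψ' : Spinor J) :
    spinorInner J φ (ψ + ψ') = spinorInner J φ ψ + spinorInner J φ ψ' := by
  rw [← conj_spinorInner, spinorInner_add_left, map_add, conj_spinorInner, conj_spinorInner]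

theorem spinorInner_smul_right (c : ℂ) (φ ψ : Spinor J) :
    spinorInner J φ (c • ψ) = c * spinorInner J φ ψ := by
  rw [← conj_spinorInner, spinorInner_smul_left, map_mul, conj_spinorInner, Complex.conj_conj]

theorem spinorInner_neg_left (φ ψ : Spinor J) : spinorInner J (-φ) ψ = -spinorInner J φ ψ := by
  rw [← neg_one_smul ℂ φ, spinorInner_smul_left]; simp

theorem spinorInner_neg_right (φ ψ : Spinor J) : spinorInner J φ (-ψ) = -spinorInner J φ ψ := by
  rw [← neg_one_smul ℂ ψ, spinorInner_smul_right]; simp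

theorem spinorInner_sub_left (φ φ' ψ : Spinor J) :
    spinorInner J (φ - φ') ψ = spinorInner J φ ψ - spinorInner J φ' ψ := by
  rw [sub_eq_add_neg, spinorInner_add_left, spinorInner_neg_left, sub_eq_add_neg]

theorem spinorInner_sub_right (φ ψ ψ' : Spinor J) :
    spinorInner J φ (ψ - ψ') = spinorInner J φ ψ - spinorInner J φ ψ' := by
  rw [sub_eq_add_neg, spinorInner_add_right, spinorInner_neg_right, sub_eq_add_neg]

theorem spinorInner_sum_left {ι : Type*} (s : Finset ι) (φ : ι → Spinor J) (ψ : Spinor J) :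
    spinorInner J (∑ i ∈ s, φ i) ψ = ∑ i ∈ s, spinorInner J (φ i) ψ :=
  map_sum (AddMonoidHom.mk' (fun φ => spinorInner J φ ψ)
    fun a b => spinorInner_add_left a b ψ) φ s

theorem spinorInner_sum_right {ι : Type*} (s : Finset ι) (φ : Spinor J) (ψ : ι → Spinor J) :
    spinorInner J φ (∑ i ∈ s, ψ i) = ∑ i ∈ s, spinorInner J φ (ψ i) :=
  map_sum (AddMonoidHom.mk' (spinorInner J φ) (spinorInner_add_right φ)) ψ s

theorem eq_zero_of_spinorInner_self {ψ : Spinor J} (h : spinorInner J ψ ψ = 0) : ψ = 0 := by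
  have hre : (spinorInner J ψ ψ).re = ∑ k ∈ Finset.range (Module.finrank ℝ T + 1),
      (1 / (k.factorial : ℝ)) * ∑ f : Fin k → Fin (Module.finrank ℝ T),
        Complex.normSq ((ψ k : T [⋀^Fin k]→ₗ[ℝ] ℂ) (stdOrthonormalBasis ℝ T ∘ f)) := by
    rw [← Complex.ofReal_re (∑ k ∈ _, _)]
    congr 1
    push_cast
    simp only [spinorInner, Complex.normSq_eq_conj_mul_self]
  rw [h, Complex.zero_re] at hre
  have h0 := (Finset.sum_eq_zero_iff_of_nonneg fun k _ => mul_nonneg (by positivity)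
    (Finset.sum_nonneg fun f _ => Complex.normSq_nonneg _)).1 hre.symm
  funext k
  apply Subtype.ext
  by_cases hk : k ∈ Finset.range (Module.finrank ℝ T + 1)
  · refine alternatingMap_eq_zero_of_basis (stdOrthonormalBasis ℝ T) fun f => ?_
    have h1 := (mul_eq_zero.1 (h0 k hk)).resolve_left
      (one_div_ne_zero (by exact_mod_cast k.factorial_ne_zero))
    exact Complex.normSq_eq_zero.1 ((Finset.sum_eq_zero_iff_of_nonneg
      fun f _ => Complex.normSq_nonneg _).1 h1 f (Finset.mem_univ f))
  · exact alternatingMap_eq_zero_of_lt (stdOrthonormalBasis ℝ T) (by simpa using hk) _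

/-- Polarization: an operator on a complex inner product space is determined by its
quadratic form. -/
theorem eq_zero_of_spinorInner_apply_self {A : Spinor J →ₗ[ℂ] Spinor J}
    (h : ∀ ψ, spinorInner J ψ (A ψ) = 0) : A = 0 := by
  ext1 ψ
  refine eq_zero_of_spinorInner_self ?_
  have h1 := h (A ψ + ψ)
  have h2 := h (A ψ + Complex.I • ψ)
  simp only [map_add, map_smul, spinorInner_add_left, spinorInner_add_right, spinorInner_smul_left,
    spinorInner_smul_right, h, Complex.conj_I] at h1 h2
  linear_combination (1 / 2 : ℂ) * h1 - (Complex.I / 2) * h2 +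
    (1 / 2) * (spinorInner J (A ψ) (A ψ) - spinorInner J ψ (A (A ψ))) * Complex.I_sq

theorem spinorInner_wedgeEnd_left (hJ : J ∘ₗ J = -LinearMap.id)
    (hiso : ∀ v w, inner ℝ (J v) (J w) = inner ℝ v w) (v : T) (φ ψ : Spinor J) :
    spinorInner J (wedgeEnd hJ (flat v) φ) ψ = spinorInner J φ (contractEnd J v ψ) := by
  simp only [spinorInner]
  rw [Finset.sum_range_succ', Finset.sum_range_succ]
  congr 1
  · refine Finset.sum_congr rfl fun k _ => ?_
    simp only [coe_wedgeEnd_succ, coe_contractEnd, AlternatingMap.curryLeft_apply_apply]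
    rw [sum_conj_wedge_mul hJ hiso _ v _ (ψ (k + 1)).2, ← mul_assoc]
    congr 1
    rw [Nat.factorial_succ]
    have h1 : ((k : ℂ) + 1) ≠ 0 := by exact_mod_cast k.succ_ne_zero
    have h2 : (k.factorial : ℂ) ≠ 0 := by exact_mod_cast k.factorial_ne_zero
    push_cast
    field_simp
  · have : (ψ (Module.finrank ℝ T + 1) : T [⋀^Fin (Module.finrank ℝ T + 1)]→ₗ[ℝ] ℂ) = 0 :=
      alternatingMap_eq_zero_of_lt (stdOrthonormalBasis ℝ T) (Nat.lt_succ_self _) _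
    simp [this]

/-- Clifford multiplication by a real vector is skew-adjoint: exterior multiplication by
`(v♭)^{0,1}` and contraction with `v` are adjoint to each other. -/
theorem spinorInner_clifford_left (hJ : J ∘ₗ J = -LinearMap.id)
    (hiso : ∀ v w, inner ℝ (J v) (J w) = inner ℝ v w) (v : T) (φ ψ : Spinor J) :
    spinorInner J (clifford hJ v φ) ψ = -spinorInner J φ (clifford hJ v ψ) := by
  have h : spinorInner J (contractEnd J v φ) ψ = spinorInner J φ (wedgeEnd hJ (flat v) ψ) := by
    rw [← conj_spinorInner, ← spinorInner_wedgeEnd_left hJ hiso, conj_spinorInner]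
  simp only [clifford, LinearMap.smul_apply, LinearMap.sub_apply, spinorInner_smul_left,
    spinorInner_smul_right, spinorInner_sub_left, spinorInner_sub_right, h,
    spinorInner_wedgeEnd_left hJ hiso, Complex.conj_ofReal]
  ring

end Inner

end KahlerSpinor

/-! ### Clifford action of two-forms -/

namespace KahlerSpinor

section CliffordRelations

variable {S : Type*} [AddCommGroup S] [Module ℂ S] {n : ℕ} {c : Fin n → S →ₗ[ℂ] S}
  {η : Fin n → Fin n → ℂ}

theorem half_sum_commutator
    (hc : ∀ i j, c i ∘ₗ c j + c j ∘ₗ c i = if i = j then (-2 : ℂ) • 1 else 0)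
    (hη : ∀ i j, η i j = -η j i) :
    ((1 / 2 : ℂ) • ∑ i, ∑ j, η i j • ((1 / 2 : ℂ) • (c i ∘ₗ c j - c j ∘ₗ c i))) =
      (1 / 2 : ℂ) • ∑ i, ∑ j, η i j • (c i ∘ₗ c j) := by
  congr 1
  refine Finset.sum_congr rfl fun i _ => Finset.sum_congr rfl fun j _ => ?_
  by_cases hij : i = j
  · have h0 : η i j = 0 := by
      subst hij
      linear_combination (1 / 2 : ℂ) * hη i i
    simp [h0]
  · have h := hc i j
    rw [if_neg hij] at h
    rw [eq_neg_of_add_eq_zero_right h]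
    module

/-- The commutator of a 2-form with a basis vector `e k` is twice the contraction of the
2-form with `e k`. -/
theorem commutator_half_sum
    (hc : ∀ i j, c i ∘ₗ c j + c j ∘ₗ c i = if i = j then (-2 : ℂ) • 1 else 0)
    (hη : ∀ i j, η i j = -η j i) (k : Fin n) (ψ : S) :
    ((1 / 2 : ℂ) • ∑ i, ∑ j, η i j • (c i ∘ₗ c j)) (c k ψ) -
      c k (((1 / 2 : ℂ) • ∑ i, ∑ j, η i j • (c i ∘ₗ c j)) ψ) = (2 : ℂ) • ∑ j, η k j • c j ψ := by
  have hc' (i j : Fin n) (φ : S) :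
      c i (c j φ) = (if i = j then (-2 : ℂ) else 0) • φ - c j (c i φ) := by
    have h := LinearMap.congr_fun (hc i j) φ
    rw [LinearMap.add_apply, LinearMap.comp_apply, LinearMap.comp_apply] at h
    rw [eq_sub_iff_add_eq, h]
    split_ifs <;> simp
  have hterm (i j : Fin n) : η i j • c i (c j (c k ψ)) - η i j • c k (c i (c j ψ)) =
      (if j = k then (-2 : ℂ) * η i j else 0) • c i ψ +
        (if i = k then (2 : ℂ) * η i j else 0) • c j ψ := by
    rw [hc' j k, hc' k i, map_sub, map_smul]
    simp only [eq_comm (a := k)]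
    split_ifs <;> module
  simp only [LinearMap.smul_apply, LinearMap.sum_apply, LinearMap.comp_apply, map_smul, map_sum]
  rw [← smul_sub, ← Finset.sum_sub_distrib]
  simp only [← Finset.sum_sub_distrib, hterm, Finset.sum_add_distrib, ite_smul, zero_smul]
  rw [Finset.sum_comm (f := fun i j => if i = k then ((2 : ℂ) * η i j) • c j ψ else 0)]
  simp only [Finset.sum_ite_eq', Finset.mem_univ, if_true]
  rw [← Finset.sum_add_distrib, Finset.smul_sum, Finset.smul_sum]
  refine Finset.sum_congr rfl fun i _ => ?_
  rw [hη i k]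
  module

end CliffordRelations

section CliffordTwoForm

variable {T : Type*} [NormedAddCommGroup T] [InnerProductSpace ℝ T] {J : T →ₗ[ℝ] T}

theorem alternating_two_swap (η : T [⋀^Fin 2]→ₗ[ℝ] ℂ) (v w : T) : η ![v, w] = -η ![w, v] := by
  have h := η.map_swap ![w, v] (i := 0) (j := 1) (by decide)
  rw [← h]
  congr 1
  ext m
  fin_cases m <;> simp

/-- The constant function `1`, as a spinor of degree zero. -/
def unitSpinor (J : T →ₗ[ℝ] T) : Spinor J
  | 0 => ⟨AlternatingMap.constOfIsEmpty ℝ T (Fin 0) 1, fun _ i => i.elim0⟩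
  | _ + 1 => 0

theorem unitSpinor_ne_zero : unitSpinor J ≠ 0 := fun h => by
  have h0 := congrArg (fun ψ : Spinor J => (ψ 0 : T [⋀^Fin 0]→ₗ[ℝ] ℂ) 0) h
  simp [unitSpinor] at h0

variable [FiniteDimensional ℝ T]

theorem clifford_basis_relation (hJ : J ∘ₗ J = -LinearMap.id)
    (hiso : ∀ v w, inner ℝ (J v) (J w) = inner ℝ v w) (i j : Fin (Module.finrank ℝ T)) :
    clifford hJ (stdOrthonormalBasis ℝ T i) ∘ₗ clifford hJ (stdOrthonormalBasis ℝ T j) +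
      clifford hJ (stdOrthonormalBasis ℝ T j) ∘ₗ clifford hJ (stdOrthonormalBasis ℝ T i) =
        if i = j then (-2 : ℂ) • 1 else 0 := by
  ext1 ψ
  rw [LinearMap.add_apply, LinearMap.comp_apply, LinearMap.comp_apply,
    clifford_clifford_add_swap hJ hiso,
    orthonormal_iff_ite.1 (stdOrthonormalBasis ℝ T).orthonormal]
  split_ifs <;> simp only [Complex.ofReal_one, Complex.ofReal_zero, mul_one, mul_zero, zero_smul,
    LinearMap.smul_apply, Module.End.one_apply, LinearMap.zero_apply]

theorem cliffordTwoForm_eq (hJ : J ∘ₗ J = -LinearMap.id)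
    (hiso : ∀ v w, inner ℝ (J v) (J w) = inner ℝ v w) (η : T [⋀^Fin 2]→ₗ[ℝ] ℂ) :
    cliffordTwoForm hJ η = (1 / 2 : ℂ) • ∑ i, ∑ j,
      η ![stdOrthonormalBasis ℝ T i, stdOrthonormalBasis ℝ T j] •
        (clifford hJ (stdOrthonormalBasis ℝ T i) ∘ₗ clifford hJ (stdOrthonormalBasis ℝ T j)) :=
  half_sum_commutator (c := fun i => clifford hJ (stdOrthonormalBasis ℝ T i))
    (η := fun i j => η ![stdOrthonormalBasis ℝ T i, stdOrthonormalBasis ℝ T j])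
    (clifford_basis_relation hJ hiso) fun _ _ => alternating_two_swap η _ _

theorem cliffordTwoForm_clifford (hJ : J ∘ₗ J = -LinearMap.id)
    (hiso : ∀ v w, inner ℝ (J v) (J w) = inner ℝ v w) (η : T [⋀^Fin 2]→ₗ[ℝ] ℂ)
    (k : Fin (Module.finrank ℝ T)) (ψ : Spinor J) :
    cliffordTwoForm hJ η (clifford hJ (stdOrthonormalBasis ℝ T k) ψ) =
      clifford hJ (stdOrthonormalBasis ℝ T k) (cliffordTwoForm hJ η ψ) +
        (2 : ℂ) • ∑ j, η ![stdOrthonormalBasis ℝ T k, stdOrthonormalBasis ℝ T j] •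
          clifford hJ (stdOrthonormalBasis ℝ T j) ψ := by
  have h := commutator_half_sum (c := fun i => clifford hJ (stdOrthonormalBasis ℝ T i))
    (η := fun i j => η ![stdOrthonormalBasis ℝ T i, stdOrthonormalBasis ℝ T j])
    (clifford_basis_relation hJ hiso) (fun _ _ => alternating_two_swap η _ _) k ψ
  rw [cliffordTwoForm_eq hJ hiso, ← h]
  abel

theorem clifford_basis_sq (hJ : J ∘ₗ J = -LinearMap.id)
    (hiso : ∀ v w, inner ℝ (J v) (J w) = inner ℝ v w) (k : Fin (Module.finrank ℝ T))
    (ψ : Spinor J) :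
    clifford hJ (stdOrthonormalBasis ℝ T k) (clifford hJ (stdOrthonormalBasis ℝ T k) ψ) = -ψ := by
  have h := LinearMap.congr_fun (clifford_basis_relation hJ hiso k k) ψ
  simp only [LinearMap.add_apply, LinearMap.comp_apply, if_true, LinearMap.smul_apply,
    Module.End.one_apply] at h
  linear_combination (norm := module) (1 / 2 : ℂ) • h

/-- In real dimension four, `∑ k, c(e_k) c(η) c(e_k) = 0` for every 2-form `η`; in dimension `n`
the sum is `(4 - n) c(η)`. -/
theorem sum_clifford_cliffordTwoForm_clifford (hJ : J ∘ₗ J = -LinearMap.id)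
    (hiso : ∀ v w, inner ℝ (J v) (J w) = inner ℝ v w) (hT : Module.finrank ℝ T = 4)
    (η : T [⋀^Fin 2]→ₗ[ℝ] ℂ) (ψ : Spinor J) :
    ∑ k, clifford hJ (stdOrthonormalBasis ℝ T k)
      (cliffordTwoForm hJ η (clifford hJ (stdOrthonormalBasis ℝ T k) ψ)) = 0 := by
  have h : ∑ k, ∑ j, η ![stdOrthonormalBasis ℝ T k, stdOrthonormalBasis ℝ T j] •
      clifford hJ (stdOrthonormalBasis ℝ T k) (clifford hJ (stdOrthonormalBasis ℝ T j) ψ) =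
        (2 : ℂ) • cliffordTwoForm hJ η ψ := by
    simp [cliffordTwoForm_eq hJ hiso, smul_smul]
  simp only [cliffordTwoForm_clifford hJ hiso, map_add, map_smul, map_sum,
    clifford_basis_sq hJ hiso, Finset.sum_add_distrib, ← Finset.smul_sum, h, Finset.sum_const,
    Finset.card_univ, Fintype.card_fin, hT]
  module

theorem eq_zero_of_cliffordTwoForm_eq_zero (hJ : J ∘ₗ J = -LinearMap.id)
    (hiso : ∀ v w, inner ℝ (J v) (J w) = inner ℝ v w) {η : T [⋀^Fin 2]→ₗ[ℝ] ℂ}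
    (h : cliffordTwoForm hJ η = 0) : η = 0 := by
  have h1 (k : Fin (Module.finrank ℝ T)) (ψ : Spinor J) :
      ∑ j, η ![stdOrthonormalBasis ℝ T k, stdOrthonormalBasis ℝ T j] •
        clifford hJ (stdOrthonormalBasis ℝ T j) ψ = 0 := by
    have h2 := cliffordTwoForm_clifford hJ hiso η k ψ
    simp only [h, LinearMap.zero_apply, map_zero, zero_add] at h2
    exact (smul_eq_zero.1 h2.symm).resolve_left two_ne_zero
  refine alternatingMap_eq_zero_of_basis (stdOrthonormalBasis ℝ T) fun f => ?_
  have hf : stdOrthonormalBasis ℝ T ∘ f =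
      ![stdOrthonormalBasis ℝ T (f 0), stdOrthonormalBasis ℝ T (f 1)] := by
    ext m
    fin_cases m <;> rfl
  rw [hf]
  -- Anticommuting the covector `η(e_k, ·)` with `e_l` isolates the coefficient `η(e_k, e_l)`.
  have h3 := h1 (f 0) (clifford hJ (stdOrthonormalBasis ℝ T (f 1)) (unitSpinor J))
  have h4 := congrArg (clifford hJ (stdOrthonormalBasis ℝ T (f 1))) (h1 (f 0) (unitSpinor J))
  have h5 := congrArg₂ (· + ·) h3 h4
  rw [map_zero, add_zero] at h5
  simp only [map_sum, map_smul, ← Finset.sum_add_distrib, ← smul_add,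
    clifford_clifford_add_swap hJ hiso,
    orthonormal_iff_ite.1 (stdOrthonormalBasis ℝ T).orthonormal] at h5
  rw [Finset.sum_eq_single_of_mem (f 1) (Finset.mem_univ _) fun j _ hj => by simp [hj]] at h5
  simpa only [if_true, Complex.ofReal_one, mul_one, smul_eq_zero, neg_eq_zero, two_ne_zero,
    unitSpinor_ne_zero, or_false] using h5

theorem cliffordTwoForm_neg (hJ : J ∘ₗ J = -LinearMap.id) (η : T [⋀^Fin 2]→ₗ[ℝ] ℂ) :
    cliffordTwoForm hJ (-η) = -cliffordTwoForm hJ η := by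
  ext1 ψ
  simp only [cliffordTwoForm, AlternatingMap.neg_apply, LinearMap.smul_apply, LinearMap.sum_apply,
    LinearMap.neg_apply, neg_smul, Finset.sum_neg_distrib, smul_neg]

/-- In real dimension four a nonzero 2-form does not act positive semidefinitely: the operators
`-c(e_k) c(η) c(e_k)` are unitarily equivalent to `c(η)` and add up to zero. -/
theorem eq_zero_of_isPosSemidef_cliffordTwoForm (hJ : J ∘ₗ J = -LinearMap.id)
    (hiso : ∀ v w, inner ℝ (J v) (J w) = inner ℝ v w) (hT : Module.finrank ℝ T = 4)
    {η : T [⋀^Fin 2]→ₗ[ℝ] ℂ} (h : IsPosSemidef (cliffordTwoForm hJ η)) : η = 0 := by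
  refine eq_zero_of_cliffordTwoForm_eq_zero hJ hiso (eq_zero_of_spinorInner_apply_self ?_)
  have hsum (ψ : Spinor J) : ∑ k, spinorInner J (clifford hJ (stdOrthonormalBasis ℝ T k) ψ)
      (cliffordTwoForm hJ η (clifford hJ (stdOrthonormalBasis ℝ T k) ψ)) = 0 := by
    simp only [spinorInner_clifford_left hJ hiso, Finset.sum_neg_distrib, ← spinorInner_sum_right,
      sum_clifford_cliffordTwoForm_clifford hJ hiso hT]
    simpa using spinorInner_smul_right 0 ψ ψ
  have hzero (k : Fin (Module.finrank ℝ T)) (ψ : Spinor J) :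
      spinorInner J (clifford hJ (stdOrthonormalBasis ℝ T k) ψ)
        (cliffordTwoForm hJ η (clifford hJ (stdOrthonormalBasis ℝ T k) ψ)) = 0 := by
    have h1 := congrArg Complex.re (hsum ψ)
    rw [Complex.re_sum, Complex.zero_re,
      Finset.sum_eq_zero_iff_of_nonneg fun k _ => (h _).2] at h1
    exact Complex.ext (h1 k (Finset.mem_univ k)) (h _).1
  intro ψ
  let k : Fin (Module.finrank ℝ T) := ⟨0, by omega⟩
  have h2 := hzero k (clifford hJ (stdOrthonormalBasis ℝ T k) ψ)
  rwa [clifford_basis_sq hJ hiso, map_neg, spinorInner_neg_left, spinorInner_neg_right,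
    neg_neg] at h2

theorem isHermitianOp_cliffordTwoForm (hJ : J ∘ₗ J = -LinearMap.id)
    (hiso : ∀ v w, inner ℝ (J v) (J w) = inner ℝ v w) {η : T [⋀^Fin 2]→ₗ[ℝ] ℂ}
    (hη : ∀ v, (η v).re = 0) : IsHermitianOp (cliffordTwoForm hJ η) := by
  intro φ ψ
  have hconj (v w : T) : starRingEnd ℂ (η ![v, w]) = η ![w, v] := by
    rw [alternating_two_swap η w v]
    apply Complex.ext <;> simp [hη]
  simp only [cliffordTwoForm_eq hJ hiso, LinearMap.smul_apply, LinearMap.sum_apply,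
    LinearMap.comp_apply, spinorInner_smul_left, spinorInner_smul_right, spinorInner_sum_left,
    spinorInner_sum_right, hconj, spinorInner_clifford_left hJ hiso, neg_neg]
  rw [Finset.sum_comm]
  simp [Complex.conj_ofNat]

/-- A nonzero purely imaginary 2-form in real dimension four acts as an indefinite Hermitian
operator. -/
theorem isIndefinite_cliffordTwoForm (hJ : J ∘ₗ J = -LinearMap.id)
    (hiso : ∀ v w, inner ℝ (J v) (J w) = inner ℝ v w) (hT : Module.finrank ℝ T = 4)
    {η : T [⋀^Fin 2]→ₗ[ℝ] ℂ} (hη : ∀ v, (η v).re = 0) (h0 : η ≠ 0) :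
    IsIndefinite (cliffordTwoForm hJ η) := by
  have hH := isHermitianOp_cliffordTwoForm hJ hiso hη
  have him (ψ : Spinor J) : (spinorInner J ψ (cliffordTwoForm hJ η ψ)).im = 0 := by
    rw [← Complex.conj_eq_iff_im, conj_spinorInner, hH]
  refine ⟨hH, ?_, ?_⟩
  · by_contra! hneg
    refine h0 (neg_eq_zero.1 (eq_zero_of_isPosSemidef_cliffordTwoForm hJ hiso hT fun ψ => ?_))
    simpa [cliffordTwoForm_neg, spinorInner_neg_right, him] using hneg ψ
  · by_contra! hpos
    exact h0 (eq_zero_of_isPosSemidef_cliffordTwoForm hJ hiso hT fun ψ => ⟨him ψ, hpos ψ⟩)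

end CliffordTwoForm

end KahlerSpinor

/-! ### Curvature of unitary connections -/

namespace KahlerSpinor

/-- If the real part of a 1-form is exact, then the real part of its exterior derivative
vanishes. -/
theorem re_extDeriv_eq_zero {E : Type*} [NormedAddCommGroup E] [NormedSpace ℝ E]
    {θ : E → E [⋀^Fin 1]→L[ℝ] ℂ} {g : E → ℝ} {y : E} (hg : ContDiffAt ℝ ∞ g y)
    (h : ∀ᶠ z in 𝓝 y, ∀ v, (θ z v).re = fderiv ℝ g z (v 0)) (v : Fin 2 → E) :
    (extDeriv θ y v).re = 0 := by
  by_cases hθ : DifferentiableAt ℝ θ y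
  · have hsymm := (hg.isSymmSndFDerivAt (by simp; norm_cast)) (v 0) (v 1)
    have hd : DifferentiableAt ℝ (fderiv ℝ g) y :=
      (hg.fderiv_right (m := 1) (by norm_cast)).differentiableAt (by simp)
    have hpart (u w : E) : (fderiv ℝ θ y u ![w]).re = fderiv ℝ (fderiv ℝ g) y u w := by
      have h1 : HasFDerivAt (fun z => (θ z ![w]).re)
          (Complex.reCLM ∘L (ContinuousAlternatingMap.apply ℝ E ℂ ![w]) ∘L fderiv ℝ θ y) y :=
        Complex.reCLM.hasFDerivAt.comp y
          ((ContinuousAlternatingMap.apply ℝ E ℂ ![w]).hasFDerivAt.comp y hθ.hasFDerivAt)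
      have h2 : HasFDerivAt (fun z => fderiv ℝ g z w)
          ((ContinuousLinearMap.apply ℝ ℝ w) ∘L fderiv ℝ (fderiv ℝ g) y) y :=
        (ContinuousLinearMap.apply ℝ ℝ w).hasFDerivAt.comp y hd.hasFDerivAt
      have h3 := h1.unique (h2.congr_of_eventuallyEq (h.mono fun z hz => by simpa using hz ![w]))
      simpa using DFunLike.congr_fun h3 u
    rw [extDeriv, ContinuousAlternatingMap.alternatizeUncurryFin_apply, Fin.sum_univ_two]
    have h0 : Fin.removeNth 0 v = ![v 1] := by ext m; fin_cases m; rfl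
    have h1 : Fin.removeNth 1 v = ![v 0] := by ext m; fin_cases m; rfl
    simp [h0, h1, hpart, hsymm]
  · -- The derivative of `θ` is zero by convention.
    simp [extDeriv, fderiv_zero_of_not_differentiableAt hθ,
      ContinuousAlternatingMap.alternatizeUncurryFin_apply]

section Geometry

variable {V : Type*} [NormedAddCommGroup V] [NormedSpace ℂ V]
  {M : Type*} [TopologicalSpace M] [ChartedSpace V M]
  {L : M → Type*} [TopologicalSpace (TotalSpace ℂ L)] [∀ x, TopologicalSpace (L x)]
  [FiberBundle ℂ L]

theorem HolomorphicSectionAt.smoothSectionAt {σ : Π x, L x} {x : M}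
    (h : HolomorphicSectionAt V σ x) : SmoothSectionAt V σ x := by
  rw [HolomorphicSectionAt, contMDiffAt_iff] at h
  rw [SmoothSectionAt, contMDiffAt_iff]
  exact ⟨h.1, (ContDiffWithinAt.restrict_scalars ℝ h.2).of_le le_top⟩

variable [∀ x, AddCommGroup (L x)] [∀ x, Module ℂ (L x)]

theorem HermitianMetric.inner_self_im (h : HermitianMetric V L) (x : M) (s : L x) :
    (h.inner x s s).im = 0 :=
  Complex.conj_eq_iff_im.1 (h.conj_symm x s s)

variable [VectorBundle ℂ ℂ L]

theorem localFrame_holomorphicSectionAt [IsManifold 𝓘(ℂ, V) ω M]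
    [ContMDiffVectorBundle ω ℂ L 𝓘(ℂ, V)] {p x : M}
    (hx : x ∈ (trivializationAt ℂ L p).baseSet) : HolomorphicSectionAt V (localFrame L p) x := by
  rw [HolomorphicSectionAt, (trivializationAt ℂ L p).contMDiffAt_section_iff hx]
  refine (contMDiffAt_const (c := (1 : ℂ))).congr_of_eventuallyEq ?_
  filter_upwards [(trivializationAt ℂ L p).open_baseSet.mem_nhds hx] with y hy
  simp [localFrame, (trivializationAt ℂ L p).apply_mk_symm hy]

theorem localFrame_ne_zero {p x : M} (hx : x ∈ (trivializationAt ℂ L p).baseSet) :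
    localFrame L p x ≠ 0 := fun h => by
  have h1 := (trivializationAt ℂ L p).continuousLinearMapAt_symmL (R := ℂ) hx (1 : ℂ)
  have h2 : (trivializationAt ℂ L p).symmL ℂ x 1 = 0 := by
    rw [Trivialization.symmL_apply _ hx]
    exact h
  rw [h2, map_zero] at h1
  exact zero_ne_one h1

variable [∀ x, IsTopologicalAddGroup (L x)] [∀ x, ContinuousSMul ℂ (L x)]

theorem apply_localFrame_eq_connectionForm_smul (D : CovariantDerivative 𝓘(ℝ, V) ℂ L) {p x : M}
    (hx : x ∈ (trivializationAt ℂ L p).baseSet) (v : TangentSpace 𝓘(ℝ, V) x) :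
    D (localFrame L p) x v = connectionForm D p x v • localFrame L p x := by
  have h1 : connectionForm D p x v =
      (trivializationAt ℂ L p ⟨x, D (localFrame L p) x v⟩).2 := by
    rw [connectionForm, ContinuousLinearMap.comp_apply,
      Trivialization.continuousLinearMapAt_apply, Trivialization.coe_linearMapAt_of_mem _ hx]
  have h2 := (trivializationAt ℂ L p).symm_apply_apply_mk hx (D (localFrame L p) x v)
  rw [← h1] at h2
  have h3 := ((trivializationAt ℂ L p).symmL ℂ x).map_smul (connectionForm D p x v) (1 : ℂ)
  rw [smul_eq_mul, mul_one, Trivialization.symmL_apply _ hx,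
    Trivialization.symmL_apply _ hx] at h3
  exact h2.symm.trans h3

/-- The curvature of a unitary connection is purely imaginary: if `s` is a nonvanishing local
section, then the real part of its connection form is `d (log h(s, s)) / 2`. -/
theorem re_curvature_eq_zero [IsManifold 𝓘(ℂ, V) ω M] [ContMDiffVectorBundle ω ℂ L 𝓘(ℂ, V)]
    (D : CovariantDerivative 𝓘(ℝ, V) ℂ L) {h : HermitianMetric V L} (hu : IsUnitary D h) (p : M)
    (v : Fin 2 → TangentSpace 𝓘(ℝ, V) p) : (curvature D p v).re = 0 := by
  let φ := chartAt V p
  let e := trivializationAt ℂ L p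
  let H : M → ℂ := fun x => h.inner x (localFrame L p x) (localFrame L p x)
  have hp : φ p ∈ φ.target := mem_chart_target V p
  have hU : φ.target ∩ φ.symm ⁻¹' e.baseSet ∈ 𝓝 (φ p) := by
    refine (φ.isOpen_inter_preimage_symm e.open_baseSet).mem_nhds ⟨hp, ?_⟩
    rw [Set.mem_preimage, φ.left_inv (mem_chart_source V p)]
    exact FiberBundle.mem_baseSet_trivializationAt' p
  have hpos (x : M) (hx : x ∈ e.baseSet) : 0 < (H x).re := h.pos x _ (localFrame_ne_zero hx)
  have hs (x : M) (hx : x ∈ e.baseSet) : SmoothSectionAt V (localFrame L p) x :=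
    (localFrame_holomorphicSectionAt hx).smoothSectionAt
  have hH (x : M) (hx : x ∈ e.baseSet) : ContMDiffAt 𝓘(ℝ, V) 𝓘(ℝ, ℂ) ∞ H x :=
    h.smooth _ _ x (hs x hx) (hs x hx)
  have hφ (z : V) (hz : z ∈ φ.target) : ContMDiffAt 𝓘(ℝ, V) 𝓘(ℝ, V) ∞ φ.symm z :=
    contMDiffOn_chart_symm.contMDiffAt (φ.open_target.mem_nhds hz)
  have hHφ (z : V) (hz : z ∈ φ.target ∩ φ.symm ⁻¹' e.baseSet) :
      ContDiffAt ℝ ∞ (H ∘ φ.symm) z :=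
    ((hH _ hz.2).comp z (hφ z hz.1)).contDiffAt
  have hre (z : V) (hz : z ∈ φ.target ∩ φ.symm ⁻¹' e.baseSet) :
      ContDiffAt ℝ ∞ (fun z => (H (φ.symm z)).re) z :=
    Complex.reCLM.contDiff.contDiffAt.comp z (hHφ z hz)
  have hder (z : V) (hz : z ∈ φ.target ∩ φ.symm ⁻¹' e.baseSet) (w : V) :
      fderiv ℝ (fun z => (H (φ.symm z)).re) z w =
        2 * (connectionFormInChart D p z ![w]).re * (H (φ.symm z)).re := by
    have h1 : fderiv ℝ (fun z => (H (φ.symm z)).re) z =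
        Complex.reCLM ∘L fderiv ℝ (H ∘ φ.symm) z :=
      (Complex.reCLM.hasFDerivAt.comp z
        ((hHφ z hz).differentiableAt (by simp)).hasFDerivAt).fderiv
    have h2 : fderiv ℝ (H ∘ φ.symm) z w =
        mfderiv 𝓘(ℝ, V) 𝓘(ℝ, ℂ) H (φ.symm z) (mfderiv 𝓘(ℝ, V) 𝓘(ℝ, V) φ.symm z w) := by
      rw [← mfderiv_eq_fderiv, mfderiv_comp z ((hH _ hz.2).mdifferentiableAt (by simp))
        ((hφ z hz.1).mdifferentiableAt (by simp))]
      rfl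
    have h3 : connectionFormInChart D p z ![w] =
        connectionForm D p (φ.symm z) (mfderiv 𝓘(ℝ, V) 𝓘(ℝ, V) φ.symm z w) := rfl
    rw [h1, ContinuousLinearMap.comp_apply, h2, hu _ _ _ (hs _ hz.2) (hs _ hz.2),
      apply_localFrame_eq_connectionForm_smul D hz.2, ← h3]
    have h4 := h.inner_self_im (φ.symm z) (localFrame L p (φ.symm z))
    simp [H, h4]
    ring
  refine re_extDeriv_eq_zero (g := fun z => 1 / 2 * Real.log (H (φ.symm z)).re) ?_ ?_ _
  · have hz := mem_of_mem_nhds hU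
    exact contDiffAt_const.mul ((hre _ hz).log (hpos _ hz.2).ne')
  · filter_upwards [hU] with z hz w
    have hw : w = ![w 0] := by ext m; fin_cases m; rfl
    have h0 := (hpos _ hz.2).ne'
    rw [fderiv_const_mul (((hre z hz).differentiableAt (by simp)).log h0),
      fderiv.log ((hre z hz).differentiableAt (by simp)) h0]
    simp only [smul_apply, smul_eq_mul, hder z hz, ← hw]
    field_simp

end Geometry

end KahlerSpinor

theorem mainTheorem1
    {V : Type*} [NormedAddCommGroup V] [NormedSpace ℂ V] [FiniteDimensional ℂ V]
    (hdim : Module.finrank ℂ V = 2)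
    {M : Type*} [TopologicalSpace M] [T2Space M] [ChartedSpace V M] [IsManifold 𝓘(ℂ, V) ω M]
    [RiemannianBundle (fun x : M => TangentSpace 𝓘(ℝ, V) x)]
    [IsContMDiffRiemannianBundle 𝓘(ℝ, V) ∞ V (fun x : M => TangentSpace 𝓘(ℝ, V) x)]
    [IsKahler V M]
    {L : M → Type*} [TopologicalSpace (TotalSpace ℂ L)] [∀ x, AddCommGroup (L x)]
    [∀ x, Module ℂ (L x)] [∀ x, TopologicalSpace (L x)] [∀ x, IsTopologicalAddGroup (L x)]
    [∀ x, ContinuousSMul ℂ (L x)] [FiberBundle ℂ L] [VectorBundle ℂ ℂ L]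
    [ContMDiffVectorBundle ω ℂ L 𝓘(ℂ, V)]
    (D : CovariantDerivative 𝓘(ℝ, V) ℂ L) (hD : IsComplexConnection D)
    (hhol : IsCompatibleWithHolomorphicStructure D)
    (p : M) (hp : curvature D p ≠ 0) :
    (¬ IsPosSemidef (curvatureOnSpinors D p) ∧ ¬ IsPosSemidef (-curvatureOnSpinors D p)) ∧
    ∀ h : HermitianMetric V L, IsUnitary D h → IsIndefinite (curvatureOnSpinors D p) := by
  have hJ := complexStructure_sq (V := V) p
  have hiso := IsKahler.inner_J (V := V) p
  have hT : Module.finrank ℝ (TangentSpace 𝓘(ℝ, V) p) = 4 := by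
    change Module.finrank ℝ V = 4
    rw [finrank_real_of_complex, hdim]
  have hη : (curvature D p).toAlternatingMap ≠ 0 := fun h0 =>
    hp (ContinuousAlternatingMap.toAlternatingMap_injective h0)
  refine ⟨⟨fun h => ?_, fun h => ?_⟩, fun h hu => ?_⟩
  · exact hη (eq_zero_of_isPosSemidef_cliffordTwoForm hJ hiso hT h)
  · rw [curvatureOnSpinors, ← cliffordTwoForm_neg] at h
    exact hη (neg_eq_zero.1 (eq_zero_of_isPosSemidef_cliffordTwoForm hJ hiso hT h))
  · exact isIndefinite_cliffordTwoForm hJ hiso hT (re_curvature_eq_zero D hu p) hη
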